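/- Let $\mathbb{D}=\{z\in\mathbb{C}:|z|<1\}$, and let $H^\infty$ be the Banach algebra of all bounded analytic functions $f:\mathbb{D}\to\mathbb{C}$ with the supremum norm $\|f\|_\infty=\sup_{z\in\mathbb{D}}|f(z)|$. For an analytic map $\varphi:\mathbb{D}\to\mathbb{D}$ let $C_\varphi$ be the composition operator $C_\varphi f=f\circ\varphi$ on $H^\infty$. Theorem 2. Let $k$ be a positive integer, let $\lambda_1,\dots,\lambda_k$ be nonzero complex numbers, and let $\varphi_1,\dots,\varphi_k$ be analytic self-maps of $\mathbb{D}$. Then the operator $\sum_{i=1}^k\lambda_i C_{\varphi_i}$ is compact on $H^\infty$ if and only if $$\lim_{n\to\infty}\|\lambda_1\varphi_1^n+\lambda_2\varphi_2^n+\cdots+\lambda_k\varphi_k^n\|_\infty=0,$$ where $\varphi_i^n$ denotes the $n$-th power $z\mapsto\varphi_i(z)^n$. -/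

import Mathlib

open Filter Topology
open scoped BoundedContinuousFunction Complex.UnitDisc

/-- `f` is analytic on the open unit disc: it is the restriction to the disc of a function
`F : ℂ → ℂ` that is complex differentiable on the disc (`F` is arbitrary off the disc). -/
def IsAnalyticOnDisc (f : 𝔻 → ℂ) : Prop :=
  ∃ F : ℂ → ℂ, DifferentiableOn ℂ F (Metric.ball 0 1) ∧ ∀ z : 𝔻, F z = f z

theorem IsAnalyticOnDisc.continuous {f : 𝔻 → ℂ} (hf : IsAnalyticOnDisc f) : Continuous f := by
  obtain ⟨F, hF, h⟩ := hf
  have : f = fun z : 𝔻 => F z := funext fun z => (h z).symm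
  rw [this]
  exact hF.continuousOn.comp_continuous Complex.UnitDisc.continuous_coe
    fun z => mem_ball_zero_iff.2 z.norm_lt_one

/-- The Banach algebra `H^∞` of bounded analytic functions on the unit disc. It carries the
supremum norm, inherited from the bounded continuous functions on the disc. -/
def HInfty : Subalgebra ℂ (𝔻 →ᵇ ℂ) where
  carrier := {f | IsAnalyticOnDisc f}
  mul_mem' := by
    rintro f g ⟨F, hF, hFf⟩ ⟨G, hG, hGg⟩
    exact ⟨F * G, hF.mul hG, fun z => by simp [hFf, hGg]⟩
  add_mem' := by
    rintro f g ⟨F, hF, hFf⟩ ⟨G, hG, hGg⟩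
    exact ⟨F + G, hF.add hG, fun z => by simp [hFf, hGg]⟩
  algebraMap_mem' c := ⟨fun _ => c, differentiableOn_const c, fun z => by simp⟩

/-- The norm of `H^∞` is the supremum norm over the disc. -/
theorem HInfty.norm_eq_iSup (f : HInfty) : ‖f‖ = ⨆ z : 𝔻, ‖(f : 𝔻 →ᵇ ℂ) z‖ :=
  BoundedContinuousFunction.norm_eq_iSup_norm (f : 𝔻 →ᵇ ℂ)

/-- Analytic self-maps of the unit disc. -/
structure AnalyticSelfMap where
  /-- The underlying map of the open unit disc into itself. -/
  toFun : 𝔻 → 𝔻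
  analytic : IsAnalyticOnDisc fun z => (toFun z : ℂ)

namespace AnalyticSelfMap

theorem continuous (φ : AnalyticSelfMap) : Continuous φ.toFun :=
  Complex.UnitDisc.isEmbedding_coe.continuous_iff.2 φ.analytic.continuous

/-- An analytic self-map of the disc, regarded as an element of `H^∞`. -/
noncomputable def toHInfty (φ : AnalyticSelfMap) : HInfty :=
  ⟨BoundedContinuousFunction.ofNormedAddCommGroup (fun z => (φ.toFun z : ℂ))
    φ.analytic.continuous 1 fun z => (φ.toFun z).norm_lt_one.le, φ.analytic⟩

theorem toHInfty_apply (φ : AnalyticSelfMap) (z : 𝔻) :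
    (φ.toHInfty : 𝔻 →ᵇ ℂ) z = φ.toFun z := rfl

/-- The composition operator `C_φ f = f ∘ φ` as a bounded operator on `H^∞`. -/
noncomputable def compOp (φ : AnalyticSelfMap) : HInfty →L[ℂ] HInfty :=
  LinearMap.mkContinuous
    { toFun := fun f => ⟨(f : 𝔻 →ᵇ ℂ).compContinuous ⟨φ.toFun, φ.continuous⟩, by
        obtain ⟨F, hF, hFf⟩ := f.2
        obtain ⟨Φ, hΦ, hΦφ⟩ := φ.analytic
        refine ⟨F ∘ Φ, hF.comp hΦ fun z hz => ?_, fun z => ?_⟩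
        · have h := hΦφ ⟨z, hz⟩
          change Φ z = _ at h
          rw [h]
          exact mem_ball_zero_iff.2 (Complex.UnitDisc.norm_lt_one _)
        · change F (Φ z) = (f : 𝔻 →ᵇ ℂ) (φ.toFun z)
          rw [hΦφ, hFf]⟩
      map_add' := fun _ _ => rfl
      map_smul' := fun _ _ => rfl }
    1 fun f => by
      rw [one_mul]
      exact (BoundedContinuousFunction.norm_le (norm_nonneg f)).2 fun z =>
        (f : 𝔻 →ᵇ ℂ).norm_coe_le_norm (φ.toFun z)

theorem compOp_apply (φ : AnalyticSelfMap) (f : HInfty) (z : 𝔻) :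
    (φ.compOp f : 𝔻 →ᵇ ℂ) z = (f : 𝔻 →ᵇ ℂ) (φ.toFun z) := rfl

end AnalyticSelfMap

/-! Necessity: the monomials `z ^ n` lie in the unit ball and are sent to `∑ λᵢ φᵢ ^ n`, which tends
to zero pointwise, so zero is its only norm cluster point in a compact set. Sufficiency: by Montel,
it suffices that the operator turns bounded locally uniform convergence along an ultrafilter into
norm convergence. Otherwise there are points `z_f` at which `∑ λᵢ h_f (wᵢ)`, with `wᵢ = φᵢ (z_f)`
and `h_f → 0` locally uniformly, stays large. The limits of `wᵢ ^ n` are characters `χᵢ` in the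
family of exponents `n`. Where `|wᵢ|` has limit below 1, `h_f (wᵢ) → 0`. Otherwise indices with
equal characters have pseudohyperbolically close points, hence a common limit of `h_f`, and Dedekind
independence of characters makes their `λ` add up to zero
(`tendsto_sum_mul_apply_of_tendsto_sum_mul_pow`). -/

/-! ### Powers and pseudohyperbolic distance -/

/-- If the powers of `a` and `b` up to an exponent `N` for which `a ^ N` is not small are close,
then `a` and `b` are within `O(1 / N)` of each other. -/
theorem norm_sub_le_of_norm_pow_sub_pow_le {a b : ℂ} {δ : ℝ} {N : ℕ} (hN : 0 < N)
    (ha : ‖a‖ ≤ 1) (haN : 1 / 2 ≤ ‖a‖ ^ N) (hδ : δ ≤ 1 / 4)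
    (h : ∀ n ≤ N, ‖b ^ n - a ^ n‖ ≤ δ) : ‖b - a‖ ≤ 4 * δ / N := by
  have ha0 : a ≠ 0 := by
    rintro rfl
    rw [norm_zero, zero_pow hN.ne'] at haN
    norm_num at haN
  have hpow : ∀ n ≤ N, ‖(b / a) ^ n - 1‖ ≤ 2 * δ := by
    intro n hn
    have han : 1 / 2 ≤ ‖a‖ ^ n := haN.trans (pow_le_pow_of_le_one (norm_nonneg a) ha hn)
    have heq : (b / a) ^ n - 1 = (b ^ n - a ^ n) / a ^ n := by
      rw [div_pow]; field_simp
    rw [heq, norm_div, norm_pow, div_le_iff₀ (by linarith)]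
    have h0 : 0 ≤ δ := (norm_nonneg _).trans (h n hn)
    nlinarith [h n hn]
  have hN' : (0 : ℝ) < N := Nat.cast_pos.2 hN
  -- With `q = b / a`, every `q ^ p` is within `1 / 2` of 1, so the geometric sum is large, while
  -- its product with `q - 1` is `q ^ N - 1`.
  have hsum : (N : ℝ) / 2 ≤ ‖∑ p ∈ Finset.range N, (b / a) ^ p‖ := by
    have h1 : ‖∑ p ∈ Finset.range N, ((b / a) ^ p - 1)‖ ≤ N * (2 * δ) := by
      refine (norm_sum_le_of_le _ fun p hp => hpow p (Finset.mem_range.1 hp).le).trans ?_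
      simp
    rw [Finset.sum_sub_distrib] at h1
    simp only [Finset.sum_const, Finset.card_range, nsmul_eq_mul, mul_one] at h1
    have h2 := norm_sub_norm_le (N : ℂ) (∑ p ∈ Finset.range N, (b / a) ^ p)
    rw [norm_sub_rev, Complex.norm_natCast] at h2
    nlinarith
  have hq : ‖b / a - 1‖ * (N / 2) ≤ 2 * δ := by
    refine le_trans ?_ (hpow N le_rfl)
    rw [← mul_geom_sum, norm_mul]
    gcongr
  have hba : b - a = a * (b / a - 1) := by field_simp
  rw [hba, norm_mul, le_div_iff₀ hN']
  nlinarith [mul_le_mul_of_nonneg_right ha (norm_nonneg (b / a - 1))]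

/-- Bernoulli: `r ^ N ≥ 1 - N (1 - r)`. -/
theorem half_le_pow_floor {r : ℝ} (h0 : 0 ≤ r) (h1 : r < 1) :
    1 / 2 ≤ r ^ ⌊1 / (2 * (1 - r))⌋₊ := by
  have hs : 0 < 2 * (1 - r) := by linarith
  have hf := Nat.floor_le (one_div_nonneg.2 hs.le)
  rw [le_div_iff₀ hs] at hf
  have hB := one_add_mul_le_pow (a := r - 1) (by linarith) ⌊1 / (2 * (1 - r))⌋₊
  rw [add_sub_cancel] at hB
  linarith

theorem inv_le_floor {r : ℝ} (h1 : r < 1) (h2 : 3 / 4 ≤ r) :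
    1 / (4 * (1 - r)) ≤ (⌊1 / (2 * (1 - r))⌋₊ : ℝ) := by
  have hs : 0 < 1 - r := by linarith
  have hf := Nat.lt_floor_add_one (1 / (2 * (1 - r)))
  have h3 : (1 : ℝ) ≤ 1 / (4 * (1 - r)) := by
    rw [le_div_iff₀ (by linarith)]; linarith
  have h4 : 1 / (2 * (1 - r)) = 1 / (4 * (1 - r)) + 1 / (4 * (1 - r)) := by
    field_simp; norm_num
  linarith

theorem tendsto_floor_inv_one_sub_atTop {J : Type*} {l : Filter J} {r : J → ℝ} (h1 : ∀ j, r j < 1)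
    (hr : Tendsto r l (𝓝 1)) : Tendsto (fun j => ⌊1 / (2 * (1 - r j))⌋₊) l atTop := by
  refine tendsto_nat_floor_atTop.comp ?_
  have h : Tendsto (fun j => 2 * (1 - r j)) l (𝓝[>] 0) := by
    refine tendsto_nhdsWithin_iff.2 ⟨?_, Eventually.of_forall fun j => ?_⟩
    · simpa using (hr.const_sub 1).const_mul 2
    · have := h1 j
      simp only [Set.mem_Ioi]
      linarith
  simpa only [one_div, Function.comp_def] using tendsto_inv_nhdsGT_zero.comp h

/-- If all powers of `a` and `b` are asymptotic to each other while `‖a‖ → 1`, then the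
pseudohyperbolic distance of `a` and `b` tends to zero. -/
theorem tendsto_norm_sub_div_of_tendsto_pow_sub_pow {J : Type*} {l : Filter J} {a b : J → ℂ}
    (ha : ∀ j, ‖a j‖ < 1) (ha1 : Tendsto (fun j => ‖a j‖) l (𝓝 1))
    (h : ∀ n : J → ℕ, Tendsto (fun j => b j ^ n j - a j ^ n j) l (𝓝 0)) :
    Tendsto (fun j => ‖b j - a j‖ / (1 - ‖a j‖)) l (𝓝 0) := by
  set N : J → ℕ := fun j => ⌊1 / (2 * (1 - ‖a j‖))⌋₊ with hN
  -- A worst exponent up to `N j` for each `j`: convergence along this one family is uniform control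
  -- over all `m ≤ N j`.
  have hmax : ∀ j, ∃ n, ∀ m ≤ N j, ‖b j ^ m - a j ^ m‖ ≤ ‖b j ^ n - a j ^ n‖ := by
    intro j
    obtain ⟨n, -, hn⟩ := Finset.exists_max_image (Finset.range (N j + 1))
      (fun m => ‖b j ^ m - a j ^ m‖) ⟨0, by simp⟩
    exact ⟨n, fun m hm => hn m (Finset.mem_range.2 (by omega))⟩
  choose n hn using hmax
  have hδ : Tendsto (fun j => ‖b j ^ n j - a j ^ n j‖) l (𝓝 0) := by
    simpa using (h n).norm
  have hδ16 : Tendsto (fun j => 16 * ‖b j ^ n j - a j ^ n j‖) l (𝓝 0) := by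
    simpa using hδ.const_mul 16
  refine squeeze_zero' (Eventually.of_forall fun j => ?_) ?_ hδ16
  · have := ha j
    exact div_nonneg (norm_nonneg _) (by linarith)
  · filter_upwards [hδ.eventually (ge_mem_nhds (show (0 : ℝ) < 1 / 4 by norm_num)),
      ha1.eventually (le_mem_nhds (show (3 / 4 : ℝ) < 1 by norm_num))] with j hj1 hj2
    have hs : 0 < 1 - ‖a j‖ := by linarith [ha j]
    have hNj := inv_le_floor (ha j) hj2
    have hpos : 0 < 1 / (4 * (1 - ‖a j‖)) := by positivity
    have hN0 : 0 < N j := by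
      have : (0 : ℝ) < N j := hpos.trans_le hNj
      exact_mod_cast this
    have := norm_sub_le_of_norm_pow_sub_pow_le hN0 (ha j).le
      (half_le_pow_floor (norm_nonneg _) (ha j)) hj1 (hn j)
    rw [div_le_iff₀ hs]
    refine this.trans ?_
    rw [div_le_iff₀ (by exact_mod_cast hN0)]
    rw [div_le_iff₀ (by positivity)] at hNj
    have h0 := norm_nonneg (b j ^ n j - a j ^ n j)
    change 1 ≤ (N j : ℝ) * _ at hNj
    nlinarith [mul_le_mul_of_nonneg_left hNj h0]

/-! ### Limits along ultrafilters and characters -/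

/-- A Lipschitz estimate for bounded analytic functions on the disc. -/
theorem dist_le_of_norm_le_on_ball {f : ℂ → ℂ} {M : ℝ} {a b : ℂ}
    (hd : DifferentiableOn ℂ f (Metric.ball 0 1)) (hM : ∀ z ∈ Metric.ball (0 : ℂ) 1, ‖f z‖ ≤ M)
    (ha : ‖a‖ < 1) (hab : ‖b - a‖ < 1 - ‖a‖) :
    dist (f b) (f a) ≤ 2 * M * (‖b - a‖ / (1 - ‖a‖)) := by
  have hsub : Metric.ball a (1 - ‖a‖) ⊆ Metric.ball 0 1 :=
    Metric.ball_subset_ball' (by rw [dist_zero_right]; linarith)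
  -- Schwarz lemma on the largest disc about `a` inside the unit disc.
  have := Complex.dist_le_div_mul_dist_of_mapsTo_ball (R₂ := 2 * M) (hd.mono hsub)
    (fun z hz => by
      rw [Metric.mem_closedBall]
      refine (dist_le_norm_add_norm _ _).trans ?_
      linarith [hM z (hsub hz), hM a (by simpa using ha)])
    (show b ∈ Metric.ball a (1 - ‖a‖) by rwa [Metric.mem_ball, dist_eq_norm])
  rw [dist_eq_norm b a] at this
  exact this.trans_eq (by ring)

theorem Ultrafilter.exists_tendsto_of_norm_le {J : Type*} (F : Ultrafilter J) {u : J → ℂ} {M : ℝ}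
    (hu : ∀ᶠ j in F, ‖u j‖ ≤ M) : ∃ c, Tendsto u F (𝓝 c) := by
  obtain ⟨c, -, hc⟩ := (isCompact_closedBall (0 : ℂ) M).ultrafilter_le_nhds' (F.map u)
    (by
      rw [Ultrafilter.mem_map]
      filter_upwards [hu] with j hj
      simpa using hj)
  exact ⟨c, hc⟩

/-- Limits along an ultrafilter of the powers `w ^ n`, as a character of the monoid of all
families of exponents `n`. -/
theorem Ultrafilter.exists_monoidHom_tendsto_pow {J : Type*} (F : Ultrafilter J) {w : J → ℂ}
    (hw : ∀ j, ‖w j‖ < 1) : ∃ χ : Multiplicative (J → ℕ) →* ℂ,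
      ∀ n : J → ℕ, Tendsto (fun j => w j ^ n j) F (𝓝 (χ (.ofAdd n))) := by
  have hlim : ∀ n : J → ℕ, ∃ c, Tendsto (fun j => w j ^ n j) F (𝓝 c) := fun n =>
    F.exists_tendsto_of_norm_le (M := 1) (Eventually.of_forall fun j => by
      rw [norm_pow]; exact pow_le_one₀ (norm_nonneg _) (hw j).le)
  choose c hc using hlim
  refine ⟨⟨⟨fun n => c n.toAdd, ?_⟩, fun m n => ?_⟩, hc⟩
  · refine tendsto_nhds_unique (hc 0) ?_
    simp
  · refine tendsto_nhds_unique (hc (m.toAdd + n.toAdd)) ?_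
    simpa only [Pi.add_apply, pow_add] using (hc m.toAdd).mul (hc n.toAdd)

/-- In a vanishing linear combination of characters, the coefficients of equal characters add
up to zero. -/
theorem sum_filter_eq_zero_of_sum_monoidHom_eq_zero {G ι : Type*} [Monoid G] [Fintype ι]
    [DecidableEq (G →* ℂ)] (χ : ι → G →* ℂ) (c : ι → ℂ) (h : ∀ g, ∑ l, c l * χ l g = 0)
    (i : ι) : ∑ l with χ l = χ i, c l = 0 := by
  have hli := linearIndependent_iff'.1 (linearIndependent_monoidHom G ℂ)
    (Finset.univ.image χ) (fun ψ => ∑ l with χ l = ψ, c l) ?_ (χ i) (by simp)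
  · exact hli
  · funext g
    simp only [Finset.sum_apply, Pi.smul_apply, smul_eq_mul, Pi.zero_apply]
    rw [← h g, ← Finset.sum_fiberwise_of_maps_to (s := Finset.univ) (t := Finset.univ.image χ)
      (g := χ) (fun l _ => by simp)]
    refine Finset.sum_congr rfl fun ψ _ => ?_
    rw [Finset.sum_mul]
    refine Finset.sum_congr rfl fun l hl => ?_
    rw [(Finset.mem_filter.1 hl).2]

theorem tendsto_apply_zero_of_norm_tendsto_lt_one {J : Type*} {l : Filter J} {w : J → ℂ}
    {h : J → ℂ → ℂ} {L : ℝ} (hL : L < 1) (hw : Tendsto (fun j => ‖w j‖) l (𝓝 L))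
    (hlu : TendstoLocallyUniformlyOn h 0 l (Metric.ball 0 1)) :
    Tendsto (fun j => h j (w j)) l (𝓝 0) := by
  obtain ⟨r, hLr, hr⟩ := exists_between hL
  have hu := (tendstoLocallyUniformlyOn_iff_forall_isCompact Metric.isOpen_ball).1 hlu
    (Metric.closedBall 0 r) (Metric.closedBall_subset_ball hr) (isCompact_closedBall 0 r)
  rw [Metric.tendstoUniformlyOn_iff] at hu
  rw [Metric.tendsto_nhds]
  intro ε hε
  filter_upwards [hu ε hε, hw.eventually (ge_mem_nhds hLr)] with j h1 h2
  rw [dist_comm]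
  exact h1 (w j) (by simpa using h2)

/-- The key step: control of the combinations of large powers of `w` controls the same
combination of any bounded family of analytic functions tending to zero locally uniformly. -/
theorem tendsto_sum_mul_apply_of_tendsto_sum_mul_pow {J ι : Type*} [Fintype ι]
    (F : Ultrafilter J) (lam : ι → ℂ) (w : ι → J → ℂ) (hw : ∀ i j, ‖w i j‖ < 1)
    (hpow : ∀ n : J → ℕ, Tendsto n F atTop →
      Tendsto (fun j => ∑ i, lam i * w i j ^ n j) F (𝓝 0))
    {h : J → ℂ → ℂ} {M : ℝ} (hd : ∀ᶠ j in F, DifferentiableOn ℂ (h j) (Metric.ball 0 1))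
    (hM : ∀ᶠ j in F, ∀ z ∈ Metric.ball (0 : ℂ) 1, ‖h j z‖ ≤ M)
    (hlu : TendstoLocallyUniformlyOn h 0 F (Metric.ball 0 1)) :
    Tendsto (fun j => ∑ i, lam i * h j (w i j)) F (𝓝 0) := by
  classical
  choose χ hχ using fun i => F.exists_monoidHom_tendsto_pow (hw i)
  have hηex : ∀ i, ∃ c, Tendsto (fun j => h j (w i j)) F (𝓝 c) := fun i =>
    F.exists_tendsto_of_norm_le (M := M) (by
      filter_upwards [hM] with j hj
      exact hj _ (by simpa using hw i j))
  choose η hη using hηex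
  have hone : ∀ i, Tendsto (fun j => ‖w i j‖) F (𝓝 ‖χ i (.ofAdd 1)‖) := fun i => by
    simpa using (hχ i 1).norm
  have hle : ∀ i, ‖χ i (.ofAdd 1)‖ ≤ 1 := fun i =>
    le_of_tendsto (hone i) (Eventually.of_forall fun j => (hw i j).le)
  have hclass : ∀ i, ∑ l with χ l = χ i, lam l * η l = 0 := by
    intro i
    rcases (hle i).lt_or_eq with hi | hi
    · refine Finset.sum_eq_zero fun l hl => ?_
      have hl' : χ l = χ i := (Finset.mem_filter.1 hl).2
      rw [tendsto_nhds_unique (hη l)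
        (tendsto_apply_zero_of_norm_tendsto_lt_one (by rwa [hl']) (hone l) hlu), mul_zero]
    · have hi1 := hone i
      rw [hi] at hi1
      have hηeq : ∀ l, χ l = χ i → η l = η i := by
        intro l hl
        have hrho := tendsto_norm_sub_div_of_tendsto_pow_sub_pow (b := w l) (hw i) hi1 fun n => by
          simpa [hl] using (hχ l n).sub (hχ i n)
        have hdist : Tendsto (fun j => dist (h j (w l j)) (h j (w i j))) F (𝓝 0) := by
          refine squeeze_zero' (Eventually.of_forall fun j => dist_nonneg) ?_
            (by simpa using hrho.const_mul (2 * M))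
          filter_upwards [hd, hM, hrho.eventually (gt_mem_nhds one_pos)] with j hdj hMj hj
          refine dist_le_of_norm_le_on_ball hdj hMj (hw i j) ?_
          rwa [div_lt_one (by linarith [hw i j])] at hj
        exact dist_eq_zero.1 (tendsto_nhds_unique ((hη l).dist (hη i)) hdist)
      -- These exponents tend to infinity, yet slowly enough that `χ i` does not vanish at them.
      set N : J → ℕ := fun j => ⌊1 / (2 * (1 - ‖w i j‖))⌋₊
      have hN : Tendsto N F atTop := tendsto_floor_inv_one_sub_atTop (hw i) hi1
      have hne : χ i (.ofAdd N) ≠ 0 := by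
        have : 1 / 2 ≤ ‖χ i (.ofAdd N)‖ := by
          refine ge_of_tendsto (hχ i N).norm (Eventually.of_forall fun j => ?_)
          rw [norm_pow]
          exact half_le_pow_floor (norm_nonneg _) (hw i j)
        exact norm_pos_iff.1 (by linarith)
      -- `hpow` only covers exponents tending to infinity; shifting by `N` admits every `n`, at the
      -- cost of the factor `χ l (.ofAdd N)`.
      have hsum := sum_filter_eq_zero_of_sum_monoidHom_eq_zero χ
        (fun l => lam l * χ l (.ofAdd N)) (fun n => by
          refine tendsto_nhds_unique ?_ (hpow (N + n.toAdd)
            (tendsto_atTop_mono (fun j => Nat.le_add_right _ _) hN))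
          refine tendsto_finsetSum _ fun l _ => ?_
          have := (hχ l (N + n.toAdd)).const_mul (lam l)
          rwa [ofAdd_add, map_mul, ← mul_assoc] at this) i
      have hlam : ∑ l with χ l = χ i, lam l = 0 := by
        refine (mul_eq_zero.1 ?_).resolve_right hne
        rw [Finset.sum_mul, ← hsum]
        refine Finset.sum_congr rfl fun l hl => ?_
        rw [(Finset.mem_filter.1 hl).2]
      calc ∑ l with χ l = χ i, lam l * η l = ∑ l with χ l = χ i, lam l * η i :=
            Finset.sum_congr rfl fun l hl => by rw [hηeq l (Finset.mem_filter.1 hl).2]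
        _ = 0 := by rw [← Finset.sum_mul, hlam, zero_mul]
  have htot : ∑ i, lam i * η i = 0 := by
    rw [← Finset.sum_fiberwise_of_maps_to (s := Finset.univ) (t := Finset.univ.image χ)
      (g := χ) (fun l _ => by simp)]
    refine Finset.sum_eq_zero fun ψ hψ => ?_
    obtain ⟨i, -, rfl⟩ := Finset.mem_image.1 hψ
    exact hclass i
  rw [← htot]
  exact tendsto_finsetSum _ fun i _ => (hη i).const_mul (lam i)

/-! ### Normal families -/

/-- Montel's theorem along an ultrafilter. -/
theorem Ultrafilter.exists_tendstoLocallyUniformlyOn {J : Type*} (F : Ultrafilter J)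
    {h : J → ℂ → ℂ} {M : ℝ} (hM0 : 0 < M)
    (hd : ∀ᶠ j in F, DifferentiableOn ℂ (h j) (Metric.ball 0 1))
    (hM : ∀ᶠ j in F, ∀ z ∈ Metric.ball (0 : ℂ) 1, ‖h j z‖ ≤ M) :
    ∃ g : ℂ → ℂ, TendstoLocallyUniformlyOn h g F (Metric.ball 0 1) := by
  have hlim : ∀ z : ℂ, ∃ c, z ∈ Metric.ball (0 : ℂ) 1 → Tendsto (fun j => h j z) F (𝓝 c) := by
    intro z
    by_cases hz : z ∈ Metric.ball (0 : ℂ) 1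
    · obtain ⟨c, hc⟩ := F.exists_tendsto_of_norm_le (u := fun j => h j z) (M := M)
        (hM.mono fun j hj => hj z hz)
      exact ⟨c, fun _ => hc⟩
    · exact ⟨0, fun hz' => absurd hz' hz⟩
  choose g hg using hlim
  refine ⟨g, Metric.tendstoLocallyUniformlyOn_iff.2 fun ε hε a ha => ?_⟩
  have ha1 : ‖a‖ < 1 := by simpa using ha
  have hR : 0 < 1 - ‖a‖ := by linarith
  -- On this radius the Lipschitz bound is `ε / 4`, uniformly in `j`; such equicontinuity upgrades
  -- pointwise limits.
  set r := min (1 - ‖a‖) ((1 - ‖a‖) * (ε / (8 * M))) with hr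
  have hr0 : 0 < r := by positivity
  refine ⟨Metric.ball a r ∩ Metric.ball 0 1,
    Filter.inter_mem (mem_nhdsWithin_of_mem_nhds (Metric.ball_mem_nhds a hr0))
      self_mem_nhdsWithin, ?_⟩
  have hlip : ∀ᶠ j in F, ∀ z ∈ Metric.ball a r, dist (h j z) (h j a) ≤ ε / 4 := by
    filter_upwards [hd, hM] with j hdj hMj z hz
    rw [Metric.mem_ball, dist_eq_norm] at hz
    refine (dist_le_of_norm_le_on_ball hdj hMj ha1 (hz.trans_le (min_le_left _ _))).trans ?_
    have h1 : ‖z - a‖ / (1 - ‖a‖) ≤ ε / (8 * M) := by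
      rw [div_le_iff₀ hR, mul_comm]
      exact (hz.trans_le (min_le_right _ _)).le
    calc 2 * M * (‖z - a‖ / (1 - ‖a‖)) ≤ 2 * M * (ε / (8 * M)) := by gcongr
      _ = ε / 4 := by field_simp; norm_num
  filter_upwards [hlip, (Metric.tendsto_nhds.1 (hg a ha)) (ε / 4) (by positivity)]
    with j hj hja z hz
  have hgz : dist (g z) (g a) ≤ ε / 4 :=
    le_of_tendsto ((hg z hz.2).dist (hg a ha)) (hlip.mono fun i hi => hi z hz.1)
  have h3 := hj z hz.1
  calc dist (g z) (h j z) ≤ dist (g z) (g a) + dist (g a) (h j a) + dist (h j a) (h j z) :=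
        dist_triangle4 _ _ _ _
    _ < ε := by
        rw [dist_comm (g a), dist_comm (h j a) (h j z)]
        linarith

namespace HInfty

theorem norm_apply_le (f : HInfty) (z : 𝔻) : ‖(f : 𝔻 →ᵇ ℂ) z‖ ≤ ‖f‖ :=
  (f : 𝔻 →ᵇ ℂ).norm_coe_le_norm z

theorem norm_le_of_forall {f : HInfty} {C : ℝ} (hC : 0 ≤ C)
    (h : ∀ z, ‖(f : 𝔻 →ᵇ ℂ) z‖ ≤ C) : ‖f‖ ≤ C :=
  (BoundedContinuousFunction.norm_le hC).2 h

theorem coe_sum_smul_apply {ι : Type*} (s : Finset ι) (c : ι → ℂ) (f : ι → HInfty) (z : 𝔻) :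
    ((∑ i ∈ s, c i • f i : HInfty) : 𝔻 →ᵇ ℂ) z = ∑ i ∈ s, c i * (f i : 𝔻 →ᵇ ℂ) z := by
  classical
  induction s using Finset.induction_on with
  | empty => simp
  | insert i s hi ih => rw [Finset.sum_insert hi, Finset.sum_insert hi, ← ih]; rfl

theorem continuous_apply (z : 𝔻) : Continuous fun f : HInfty => (f : 𝔻 →ᵇ ℂ) z :=
  (BoundedContinuousFunction.lipschitz_eval_const z).continuous.comp continuous_subtype_val

/-- The closed unit ball of `H^∞` is compact for locally uniform convergence. -/
theorem exists_tendstoLocallyUniformlyOn (F : Ultrafilter HInfty)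
    (hF : Metric.closedBall (0 : HInfty) 1 ∈ F) {E : HInfty → ℂ → ℂ}
    (hE : ∀ f, DifferentiableOn ℂ (E f) (Metric.ball 0 1))
    (hEf : ∀ (f : HInfty) (z : 𝔻), E f z = (f : 𝔻 →ᵇ ℂ) z) :
    ∃ g ∈ Metric.closedBall (0 : HInfty) 1,
      TendstoLocallyUniformlyOn E (E g) F (Metric.ball 0 1) := by
  have hM : ∀ᶠ f in F, ∀ z ∈ Metric.ball (0 : ℂ) 1, ‖E f z‖ ≤ 1 := by
    filter_upwards [hF] with f hf z hz
    lift z to 𝔻 using by simpa using hz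
    rw [hEf]
    exact (norm_apply_le f z).trans (mem_closedBall_zero_iff.1 hf)
  obtain ⟨G, hG⟩ := F.exists_tendstoLocallyUniformlyOn one_pos (Eventually.of_forall hE) hM
  have hGd := hG.differentiableOn (Eventually.of_forall hE) Metric.isOpen_ball
  have hG1 : ∀ z ∈ Metric.ball (0 : ℂ) 1, ‖G z‖ ≤ 1 := fun z hz =>
    le_of_tendsto (hG.tendsto_at hz).norm (hM.mono fun f hf => hf z hz)
  have han : IsAnalyticOnDisc fun z : 𝔻 => G z := ⟨G, hGd, fun _ => rfl⟩
  have hGz : ∀ z : 𝔻, ‖G z‖ ≤ 1 := fun z => hG1 z (by simpa using z.norm_lt_one)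
  refine ⟨⟨BoundedContinuousFunction.ofNormedAddCommGroup (fun z : 𝔻 => G z) han.continuous 1 hGz,
    han⟩, ?_, hG.congr_right fun z hz => ?_⟩
  · rw [mem_closedBall_zero_iff]
    exact norm_le_of_forall zero_le_one hGz
  · lift z to 𝔻 using by simpa using hz
    rw [hEf]
    rfl

end HInfty

/-! ### Compactness of the operator -/

namespace AnalyticSelfMap

theorem toHInfty_pow_apply (φ : AnalyticSelfMap) (n : ℕ) (z : 𝔻) :
    ((φ.toHInfty ^ n : HInfty) : 𝔻 →ᵇ ℂ) z = (φ.toFun z : ℂ) ^ n := by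
  rw [SubmonoidClass.coe_pow, BoundedContinuousFunction.pow_apply, toHInfty_apply]

theorem norm_toHInfty_pow_le (φ : AnalyticSelfMap) (n : ℕ) : ‖φ.toHInfty ^ n‖ ≤ 1 :=
  HInfty.norm_le_of_forall zero_le_one fun z => by
    rw [toHInfty_pow_apply, norm_pow]
    exact pow_le_one₀ (norm_nonneg _) (φ.toFun z).norm_lt_one.le

/-- The identity map of the disc. -/
def refl : AnalyticSelfMap where
  toFun := id
  analytic := ⟨id, differentiableOn_id, fun _ => rfl⟩

theorem compOp_toHInfty_pow (φ ψ : AnalyticSelfMap) (n : ℕ) (z : 𝔻) :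
    (φ.compOp (ψ.toHInfty ^ n) : 𝔻 →ᵇ ℂ) z = (ψ.toFun (φ.toFun z) : ℂ) ^ n := by
  rw [compOp_apply, toHInfty_pow_apply]

theorem compOp_refl_pow (φ : AnalyticSelfMap) (n : ℕ) :
    φ.compOp (refl.toHInfty ^ n) = φ.toHInfty ^ n := by
  refine Subtype.ext (BoundedContinuousFunction.ext fun z => ?_)
  rw [compOp_toHInfty_pow, toHInfty_pow_apply]
  rfl

theorem sum_smul_compOp_apply {ι : Type*} [Fintype ι] (lam : ι → ℂ) (φ : ι → AnalyticSelfMap)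
    (f : HInfty) :
    (∑ i, lam i • (φ i).compOp : HInfty →L[ℂ] HInfty) f = ∑ i, lam i • (φ i).compOp f := by
  simp

theorem tendsto_norm_of_isCompactOperator {ι : Type*} [Fintype ι] (lam : ι → ℂ)
    (φ : ι → AnalyticSelfMap)
    (hT : IsCompactOperator (∑ i, lam i • (φ i).compOp : HInfty →L[ℂ] HInfty)) :
    Tendsto (fun n : ℕ => ‖∑ i, lam i • (φ i).toHInfty ^ n‖) atTop (𝓝 0) := by
  obtain ⟨K, hK, hKT⟩ := hT.image_closedBall_subset_compact (𝕜₁ := ℂ) 1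
  suffices h : Tendsto (fun n : ℕ => ∑ i, lam i • (φ i).toHInfty ^ n) atTop (𝓝 0) by
    exact tendsto_zero_iff_norm_tendsto_zero.1 h
  refine hK.tendsto_nhds_of_unique_mapClusterPt (Eventually.of_forall fun n => ?_) fun y _ hy => ?_
  · refine hKT ⟨refl.toHInfty ^ n, ?_, ?_⟩
    · rw [mem_closedBall_zero_iff]
      exact norm_toHInfty_pow_le _ n
    · change (∑ i, lam i • (φ i).compOp : HInfty →L[ℂ] HInfty) _ = _
      simp only [sum_smul_compOp_apply, compOp_refl_pow]
  · refine Subtype.ext (BoundedContinuousFunction.ext fun z => ?_)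
    have hc : MapClusterPt ((y : 𝔻 →ᵇ ℂ) z) atTop
        (fun n : ℕ => ((∑ i, lam i • (φ i).toHInfty ^ n : HInfty) : 𝔻 →ᵇ ℂ) z) :=
      hy.continuousAt_comp (HInfty.continuous_apply z).continuousAt
    have h0 : Tendsto (fun n : ℕ => ((∑ i, lam i • (φ i).toHInfty ^ n : HInfty) : 𝔻 →ᵇ ℂ) z)
        atTop (𝓝 0) := by
      simp only [HInfty.coe_sum_smul_apply, toHInfty_pow_apply]
      rw [← Finset.sum_const_zero (s := (Finset.univ : Finset ι))]
      refine tendsto_finsetSum _ fun i _ => ?_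
      simpa using (tendsto_pow_atTop_nhds_zero_of_norm_lt_one
        ((φ i).toFun z).norm_lt_one).const_mul (lam i)
    obtain ⟨u, hu, hlim⟩ := hc.tendsto_subseq
    exact tendsto_nhds_unique hlim (h0.comp hu.tendsto_atTop)

theorem isCompactOperator_of_tendsto_norm {ι : Type*} [Fintype ι] (lam : ι → ℂ)
    (φ : ι → AnalyticSelfMap)
    (h : Tendsto (fun n : ℕ => ‖∑ i, lam i • (φ i).toHInfty ^ n‖) atTop (𝓝 0)) :
    IsCompactOperator (∑ i, lam i • (φ i).compOp : HInfty →L[ℂ] HInfty) := by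
  set T : HInfty →L[ℂ] HInfty := ∑ i, lam i • (φ i).compOp with hT
  refine ⟨T '' Metric.closedBall 0 1, ?_, mem_of_superset
    (Metric.closedBall_mem_nhds 0 one_pos) (Set.subset_preimage_image _ _)⟩
  -- An ultrafilter on the image is lifted to one on the unit ball, where Montel gives a limit `g`.
  refine isCompact_iff_ultrafilter_le_nhds'.2 fun F' hF' => ?_
  set F := Ultrafilter.ofComapInfPrincipal hF'
  have hF : Metric.closedBall (0 : HInfty) 1 ∈ F := Ultrafilter.ofComapInfPrincipal_mem hF'
  have hFF' : F.map T = F' := Ultrafilter.ofComapInfPrincipal_eq_of_map hF'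
  choose E hE hEf using fun f : HInfty => f.2
  obtain ⟨g, hg, hlim⟩ := HInfty.exists_tendstoLocallyUniformlyOn F hF hE hEf
  refine ⟨T g, Set.mem_image_of_mem _ hg, ?_⟩
  rw [← hFF', Ultrafilter.coe_map]
  change Tendsto T F (𝓝 (T g))
  have happ : ∀ (f : HInfty) (z : 𝔻), (T f : 𝔻 →ᵇ ℂ) z - (T g : 𝔻 →ᵇ ℂ) z =
      ∑ i, lam i * (E f ((φ i).toFun z) - E g ((φ i).toFun z)) := by
    intro f z
    rw [hT, sum_smul_compOp_apply, sum_smul_compOp_apply, HInfty.coe_sum_smul_apply,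
      HInfty.coe_sum_smul_apply, ← Finset.sum_sub_distrib]
    simp only [compOp_apply, hEf, mul_sub]
  by_contra hnot
  simp only [Metric.tendsto_nhds, not_forall, not_eventually, not_lt] at hnot
  obtain ⟨ε, hε, hfreq⟩ := hnot
  -- The supremum need not be attained, hence `ε / 2`.
  have hex : ∀ f : HInfty, ∃ z : 𝔻, ε ≤ dist (T f) (T g) →
      ε / 2 < ‖(T f : 𝔻 →ᵇ ℂ) z - (T g : 𝔻 →ᵇ ℂ) z‖ := by
    intro f
    by_contra! hz
    have h1 : ‖T f - T g‖ ≤ ε / 2 :=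
      HInfty.norm_le_of_forall (by positivity) fun z => (hz z).2
    have h2 := (hz 0).1
    rw [dist_eq_norm] at h2
    linarith
  choose z hz using hex
  -- The index set is `HInfty` itself, each `f` carrying its own point `z f`.
  have key := tendsto_sum_mul_apply_of_tendsto_sum_mul_pow F lam
    (fun i f => ((φ i).toFun (z f) : ℂ)) (fun i f => ((φ i).toFun (z f)).norm_lt_one)
    (fun n hn => squeeze_zero_norm (fun f => by
      have := HInfty.norm_apply_le (∑ i, lam i • (φ i).toHInfty ^ n f) (z f)
      simpa only [HInfty.coe_sum_smul_apply, toHInfty_pow_apply, Function.comp_apply] using this)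
      (h.comp hn))
    (h := fun f => E f - E g) (M := 2) (Eventually.of_forall fun f => (hE f).sub (hE g))
    (by
      filter_upwards [hF] with f hf x hx
      lift x to 𝔻 using by simpa using hx
      rw [mem_closedBall_zero_iff] at hf hg
      rw [Pi.sub_apply, hEf, hEf]
      linarith [norm_sub_le ((f : 𝔻 →ᵇ ℂ) x) ((g : 𝔻 →ᵇ ℂ) x), HInfty.norm_apply_le f x,
        HInfty.norm_apply_le g x])
    (by
      rw [Metric.tendstoLocallyUniformlyOn_iff] at hlim ⊢
      intro δ hδ x hx
      obtain ⟨t, ht, hev⟩ := hlim δ hδ x hx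
      refine ⟨t, ht, hev.mono fun f hf y hy => ?_⟩
      simpa [dist_eq_norm, norm_sub_rev] using hf y hy)
  obtain ⟨f, hf1, hf2⟩ := (hfreq.and_eventually
    ((Metric.tendsto_nhds.1 key) (ε / 2) (by positivity))).exists
  have h3 := hz f hf1
  rw [happ] at h3
  rw [dist_zero_right] at hf2
  exact lt_asymm h3 hf2

end AnalyticSelfMap

theorem theorem2 (k : ℕ) (hk : 0 < k) (lam : Fin k → ℂ) (hlam : ∀ i, lam i ≠ 0)
    (φ : Fin k → AnalyticSelfMap) :
    IsCompactOperator (∑ i, lam i • (φ i).compOp : HInfty →L[ℂ] HInfty) ↔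
      Tendsto (fun n : ℕ => ‖∑ i, lam i • (φ i).toHInfty ^ n‖) atTop (𝓝 0) :=
  ⟨AnalyticSelfMap.tendsto_norm_of_isCompactOperator lam φ,
    AnalyticSelfMap.isCompactOperator_of_tendsto_norm lam φ⟩
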